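/- Fix $p\in(1,\infty)$. For $q\in[0,1)$ and $x\in\mathbf R$ put $$\mathrm F_{1,p}(x,q)=\int_0^x\frac{|\cos\theta|^{1-2/p}}{\sqrt{1-q^2\sin^2\theta}}\,d\theta,\qquad \mathrm E_{1,p}(x,q)=\int_0^x\sqrt{1-q^2\sin^2\theta}\,|\cos\theta|^{1-2/p}\,d\theta,$$ $\mathrm K_{1,p}(q)=\mathrm F_{1,p}(\pi/2,q)$ and $\mathrm E_{1,p}(q)=\mathrm E_{1,p}(\pi/2,q)$. Let $\mathrm{am}_{1,p}(\cdot,q)$ be the inverse function of $\mathrm F_{1,p}(\cdot,q)$, let $\mathrm{cn}_p=|\cos\mathrm{am}_{1,p}|^{\frac2p-1}\cos\mathrm{am}_{1,p}$, let $q^*=q^*(p)\in(0,1)$ be the unique solution of $2\mathrm E_{1,p}(q)/\mathrm K_{1,p}(q)-1=0$, and let $$\gamma_w(s,q)=\Big(2\mathrm E_{1,p}(\mathrm{am}_{1,p}(s,q),q)-s,\ -q\tfrac{p}{p-1}|\mathrm{cn}_p(s,q)|^{p-2}\mathrm{cn}_p(s,q)\Big).$$ For an integer $n\ge1$, a planar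 curve is called an $\frac n2$-fold figure-eight $p$-elastica if, up to similarity and reparameterization, it is the curve $s\mapsto\gamma_w(s-\mathrm K_{1,p}(q^*),q^*)$, $s\in[0,2n\mathrm K_{1,p}(q^*)]$; it is called half-fold if $n=1$. For an immersed planar curve $\gamma$ with length $\mathcal L[\gamma]$, signed curvature $k$ and arclength parameter $s$, the normalized $p$-bending energy is $\overline{\mathcal B}_p[\gamma]=\mathcal L[\gamma]^{p-1}\int_\gamma|k|^p\,ds$. Let $W^{2,p}_{\rm imm}(\mathbf R/\mathbf Z;\mathbf R^2)$ denote the set of closed $W^{2,p}$-curves $\gamma$ with $\gamma'\neq0$ everywhere. Such a curve has a point $P$ of multiplicity $m$ if $\gamma^{-1}(P)$ contains at least $m$ distinct points of $\mathbf R/\mathbf Z$. Put $$\varpi^*_p=2^{3p-1}(q^*)^{p-2}\big(2(q^*)^2-1\big)\,\mathrm E_{1,p}(q^*)^p.$$ **Theorem.** Let $p\in(1,\infty)$. The constant $\varpi^*_p$ is the normalized $p$-bending energy of the half-fold figure-eight $p$-elastica $s\mapsto\gamma_w(s-\mathrm K_{1,p}(q^*),q^*)$, $s\in[0,2\mathrm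 K_{1,p}(q^*)]$. If $m\ge2$ is an even integer, then there exists a closed curve $\gamma\in W^{2,p}_{\rm imm}(\mathbf R/\mathbf Z;\mathbf R^2)$ with a point of multiplicity $m$ such that $$\overline{\mathcal B}_p[\gamma]=\varpi^*_p\,m^p,$$ and $\gamma$ can be taken to be an $\frac m2$-fold figure-eight $p$-elastica. -/

import Mathlib

noncomputable section

namespace PElastica

/-- The Euclidean plane. -/
abbrev Plane : Type := EuclideanSpace ℝ (Fin 2)

/-! ### `p`-elliptic integrals and functions -/

/-- Incomplete `p`-elliptic integral of the first kind, `F_{1,p}(x, q)`. -/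
def F1 (p x q : ℝ) : ℝ :=
  ∫ θ in (0 : ℝ)..x, |Real.cos θ| ^ (1 - 2 / p) / Real.sqrt (1 - q ^ 2 * Real.sin θ ^ 2)

/-- Complete `p`-elliptic integral of the first kind, `K_{1,p}(q)`. -/
def K1 (p q : ℝ) : ℝ := F1 p (Real.pi / 2) q

/-- Incomplete `p`-elliptic integral of the second kind, `E_{1,p}(x, q)`. -/
def E1 (p x q : ℝ) : ℝ :=
  ∫ θ in (0 : ℝ)..x, Real.sqrt (1 - q ^ 2 * Real.sin θ ^ 2) * |Real.cos θ| ^ (1 - 2 / p)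

/-- Complete `p`-elliptic integral of the second kind, `E_{1,p}(q)`. -/
def E1c (p q : ℝ) : ℝ := E1 p (Real.pi / 2) q

/-- The function `Q_p(q) = 2 E_{1,p}(q) / K_{1,p}(q) - 1`. -/
def Q (p q : ℝ) : ℝ := 2 * (E1c p q / K1 p q) - 1

/-- The modulus `q^*(p)` of the figure-eight: the solution in `(0, 1)` of `Q_p(q) = 0`
(for `p > 1` there is exactly one). -/
def qStar (p : ℝ) : ℝ := Classical.epsilon fun q : ℝ => q ∈ Set.Ioo (0 : ℝ) 1 ∧ Q p q = 0

/-- The amplitude `am_{1,p}(·, q)`: the inverse function of `F_{1,p}(·, q)`, which is a bijection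
of `ℝ` for `p > 1` and `0 ≤ q < 1`. -/
def am1 (p s q : ℝ) : ℝ := Function.invFun (fun x : ℝ => F1 p x q) s

/-- The `p`-elliptic cosine `cn_p(s, q)`. -/
def cn (p s q : ℝ) : ℝ := |Real.cos (am1 p s q)| ^ (2 / p - 1) * Real.cos (am1 p s q)

/-- The wavelike `p`-elastica `γ_w(s, q)`. -/
def gammaW (p s q : ℝ) : Plane :=
  !₂[2 * E1 p (am1 p s q) q - s, -(q * (p / (p - 1)) * (|cn p s q| ^ (p - 2) * cn p s q))]

/-- The standard figure-eight arc `s ↦ γ_w(s - K_{1,p}(q^*), q^*)`. On `[0, 2 n K_{1,p}(q^*)]` it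
is the standard `n/2`-fold figure-eight `p`-elastica. -/
def figureEightArc (p s : ℝ) : Plane := gammaW p (s - K1 p (qStar p)) (qStar p)

/-- The curve `c : [0, 1] → ℝ²` is an `n/2`-fold figure-eight `p`-elastica: up to a similarity of
the plane and a (regular `C¹`) reparameterization it is `s ↦ γ_w(s - K_{1,p}(q^*), q^*)`,
`s ∈ [0, 2 n K_{1,p}(q^*)]`. -/
def IsFigureEight (p : ℝ) (n : ℕ) (c : ℝ → Plane) : Prop :=
  ∃ (S : Plane ≃ᵈ Plane) (σ : ℝ → ℝ),
    ContDiffOn ℝ 1 σ (Set.Icc 0 1) ∧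
    (∀ t ∈ Set.Icc (0 : ℝ) 1, 0 < derivWithin σ (Set.Icc 0 1) t) ∧
    σ 0 = 0 ∧ σ 1 = 2 * n * K1 p (qStar p) ∧
    ∀ t ∈ Set.Icc (0 : ℝ) 1, c t = S (figureEightArc p (σ t))

/-! ### Length and bending energy -/

/-- The length of `c` on `[a, b]`. -/
def curveLength (c : ℝ → Plane) (a b : ℝ) : ℝ := ∫ t in a..b, ‖deriv c t‖

/-- The signed curvature `det (c', c'') / |c'|³`. For an immersed `W^{2,p}` curve the derivative `c'`
is absolutely continuous, so the pointwise `c''` exists almost everywhere and is the weak one. -/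
def signedCurvature (c : ℝ → Plane) (t : ℝ) : ℝ :=
  (deriv c t 0 * deriv (deriv c) t 1 - deriv c t 1 * deriv (deriv c) t 0) / ‖deriv c t‖ ^ 3

/-- The `p`-bending energy `∫ |k|^p ds` of `c` on `[a, b]`. -/
def bendingEnergy (p : ℝ) (c : ℝ → Plane) (a b : ℝ) : ℝ :=
  ∫ t in a..b, |signedCurvature c t| ^ p * ‖deriv c t‖

/-- The normalized `p`-bending energy (length to the power `p - 1`, times the bending energy). -/
def normalizedEnergy (p : ℝ) (c : ℝ → Plane) (a b : ℝ) : ℝ :=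
  curveLength c a b ^ (p - 1) * bendingEnergy p c a b

/-- The constant `ϖ^*_p`. -/
def varpiStar (p : ℝ) : ℝ :=
  2 ^ (3 * p - 1) * qStar p ^ (p - 2) * (2 * qStar p ^ 2 - 1) * E1c p (qStar p) ^ p

/-! ### Closed immersed Sobolev curves -/

/-- `v` is the weak derivative of `u` on `ℝ`. -/
def HasWeakDeriv (u v : ℝ → Plane) : Prop :=
  MeasureTheory.LocallyIntegrable u ∧ MeasureTheory.LocallyIntegrable v ∧
    ∀ φ : ℝ → ℝ, ContDiff ℝ ((⊤ : ℕ∞) : WithTop ℕ∞) φ → HasCompactSupport φ →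
      ∫ x, deriv φ x • u x = -∫ x, φ x • v x

/-- The `1`-periodic lift to `ℝ` of a function on `ℝ / ℤ`. -/
def lift (γ : UnitAddCircle → Plane) (t : ℝ) : Plane := γ (t : UnitAddCircle)

/-- `γ` is an immersed closed `W^{2,p}` curve, `γ ∈ W^{2,p}_imm(ℝ/ℤ; ℝ²)`. An element of
`W^{2,p}` is identified with its `C¹` representative. -/
structure IsImmersedClosedW2p (p : ℝ) (γ : UnitAddCircle → Plane) : Prop where
  contDiff : ContDiff ℝ 1 (lift γ)
  weakDeriv : ∃ w : UnitAddCircle → Plane,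
    MeasureTheory.MemLp w (ENNReal.ofReal p) MeasureTheory.volume ∧
      HasWeakDeriv (deriv (lift γ)) (lift w)
  immersed : ∀ t : ℝ, deriv (lift γ) t ≠ 0

/-- `γ` has a point of multiplicity `m`: some point has at least `m` distinct preimages. -/
def HasPointOfMultiplicity (γ : UnitAddCircle → Plane) (m : ℕ) : Prop :=
  ∃ P : Plane, (m : ℕ∞) ≤ (γ ⁻¹' {P}).encard

end PElastica

end

noncomputable section

open MeasureTheory Set Filter Topology

namespace PElastica

/-! The curve `γ_w` is parametrized by arclength with curvature `2q cn_p`. Since `|cn_p|^p = cos²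
am` and `q² cos² am = δ² - (1 - q²)`, with `δ = √(1 - q² sin² am)`, and since `δ²` is the derivative
of `E_{1,p}(am)`, the bending energy of any arc has a closed form (`bendingEnergy_gammaW_affine`).
Shifting `s` by `2K` adds `π` to the amplitude and `4E - 2K` to the first coordinate. At `q^*` one
has `K = 2E`, so this drift vanishes. Each shift by `2K` from `s = -K` therefore returns to the same
point, and an even number of shifts also restores the sign of `cos am`, so the curve closes up
periodically. The starting point has `n` preimages, and inserting `K = 2E` in the length and the
energy gives `ϖ^*_p n^p`. Two analytic points remain. The amplitude may fail to be differentiable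
where `cos am = 0`, but those parameters are countable and the derivatives needed extend
continuously across them. The modulus must also exist: `2E - K` is continuous on `[0, 1)`, positive
at `0` and negative near `1` (`exists_two_mul_E1c_sub_K1_neg`). Uniqueness plays no role: the
argument works for whichever root is chosen. -/

theorem neg_one_lt_one_sub_two_div {p : ℝ} (hp : 1 < p) : -1 < 1 - 2 / p := by
  have : 2 / p < 2 := by rw [div_lt_iff₀ (by linarith)]; linarith
  linarith

theorem one_sub_two_div_lt_one {p : ℝ} (hp : 1 < p) : 1 - 2 / p < 1 := by
  have : 0 < 2 / p := by positivity
  linarith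

/-! ### Primitives with respect to the weight `|cos θ| ^ (1 - 2 / p)` -/

theorem intervalIntegrable_sin_rpow {r : ℝ} (hr : -1 < r) :
    IntervalIntegrable (fun θ : ℝ => |Real.sin θ| ^ r) volume 0 (Real.pi / 2) := by
  -- One majorant for both signs of `r`: the constant `1` serves `r ≥ 0`, and the power, through
  -- Jordan's inequality `sin θ ≥ 2θ/π`, serves `r ≤ 0`.
  have hd : IntervalIntegrable (fun θ : ℝ => (2 / Real.pi) ^ r * θ ^ r + 1) volume 0
      (Real.pi / 2) :=
    ((intervalIntegral.intervalIntegrable_rpow' hr).const_mul _).add intervalIntegrable_const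
  refine hd.mono_fun ?_ ?_
  · exact ((Real.measurable_sin.abs).pow_const r).aestronglyMeasurable
  · rw [uIoc_of_le (by positivity)]
    filter_upwards [ae_restrict_mem measurableSet_Ioc] with θ hθ
    have h0 : 0 < θ := hθ.1
    have hs := Real.mul_le_sin h0.le hθ.2
    have hm : 0 < 2 / Real.pi * θ := by positivity
    have hs0 : 0 < Real.sin θ := hm.trans_le hs
    have hb : 0 ≤ (2 / Real.pi) ^ r * θ ^ r := by positivity
    rw [Real.norm_of_nonneg (by positivity), Real.norm_of_nonneg (by positivity),
      abs_of_pos hs0]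
    rcases le_total 0 r with h | h
    · have := Real.rpow_le_one hs0.le (Real.sin_le_one θ) h
      linarith
    · have := Real.rpow_le_rpow_of_nonpos hm hs h
      rw [Real.mul_rpow (by positivity) h0.le] at this
      linarith

theorem intervalIntegrable_cos_rpow {r : ℝ} (hr : -1 < r) (a b : ℝ) :
    IntervalIntegrable (fun θ : ℝ => |Real.cos θ| ^ r) volume a b := by
  have hper : Function.Periodic (fun θ : ℝ => |Real.cos θ| ^ r) Real.pi := fun θ => by
    simp [Real.cos_add_pi]
  refine hper.intervalIntegrable Real.pi_ne_zero (t := 0) ?_ a b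
  have h1 : IntervalIntegrable (fun θ : ℝ => |Real.cos θ| ^ r) volume 0 (Real.pi / 2) := by
    have := (intervalIntegrable_sin_rpow hr).comp_sub_left (Real.pi / 2)
    simp only [Real.sin_pi_div_two_sub] at this
    simpa using this.symm
  have h2 : IntervalIntegrable (fun θ : ℝ => |Real.cos θ| ^ r) volume (Real.pi / 2) Real.pi := by
    have := h1.comp_sub_left Real.pi
    simp only [Real.cos_pi_sub, abs_neg, sub_zero] at this
    convert this.symm using 1
    ring
  simpa using h1.trans h2

theorem countable_cos_eq_zero : {θ : ℝ | Real.cos θ = 0}.Countable := by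
  refine (countable_range fun k : ℤ => (2 * (k : ℝ) + 1) * Real.pi / 2).mono fun θ hθ => ?_
  obtain ⟨k, hk⟩ := Real.cos_eq_zero_iff.1 hθ
  exact ⟨k, hk.symm⟩

/-- The primitive `x ↦ ∫₀ˣ |cos θ| ^ (1 - 2 / p) g(θ) dθ`. -/
def weightedPrimitive (p : ℝ) (g : ℝ → ℝ) (x : ℝ) : ℝ :=
  ∫ θ in (0 : ℝ)..x, |Real.cos θ| ^ (1 - 2 / p) * g θ

section weightedPrimitive

variable {p : ℝ} {g : ℝ → ℝ}

theorem intervalIntegrable_weight_mul (hp : 1 < p) (hg : Continuous g) (a b : ℝ) :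
    IntervalIntegrable (fun θ => |Real.cos θ| ^ (1 - 2 / p) * g θ) volume a b :=
  (intervalIntegrable_cos_rpow (neg_one_lt_one_sub_two_div hp) a b).mul_continuousOn
    hg.continuousOn

theorem continuous_weightedPrimitive (hp : 1 < p) (hg : Continuous g) :
    Continuous (weightedPrimitive p g) :=
  intervalIntegral.continuous_primitive (intervalIntegrable_weight_mul hp hg) 0

theorem hasDerivAt_weightedPrimitive (hp : 1 < p) (hg : Continuous g) {x : ℝ}
    (hx : Real.cos x ≠ 0) :
    HasDerivAt (weightedPrimitive p g) (|Real.cos x| ^ (1 - 2 / p) * g x) x := by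
  refine intervalIntegral.integral_hasDerivAt_right (intervalIntegrable_weight_mul hp hg 0 x)
    ?_ ?_
  · have : Measurable fun θ => |Real.cos θ| ^ (1 - 2 / p) * g θ :=
      ((Real.measurable_cos.abs).pow_const _).mul hg.measurable
    exact this.stronglyMeasurable.stronglyMeasurableAtFilter
  · exact (Real.continuous_cos.abs.continuousAt.rpow_const (Or.inl (abs_ne_zero.2 hx))).mul
      hg.continuousAt

theorem weightedPrimitive_sub (hp : 1 < p) (hg : Continuous g) (a b : ℝ) :
    weightedPrimitive p g b - weightedPrimitive p g a =
      ∫ θ in a..b, |Real.cos θ| ^ (1 - 2 / p) * g θ :=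
  intervalIntegral.integral_interval_sub_left (intervalIntegrable_weight_mul hp hg 0 b)
    (intervalIntegrable_weight_mul hp hg 0 a)

theorem strictMono_weightedPrimitive (hp : 1 < p) (hg : Continuous g) (h0 : ∀ x, 0 < g x) :
    StrictMono (weightedPrimitive p g) := by
  intro a b hab
  rw [← sub_pos, weightedPrimitive_sub hp hg,
    intervalIntegral.integral_pos_iff_support_of_nonneg_ae
      (Eventually.of_forall fun θ => mul_nonneg (by positivity) (h0 θ).le)
      (intervalIntegrable_weight_mul hp hg a b)]
  refine ⟨hab, ?_⟩
  -- At a zero of `cos` the real power `0 ^ (1 - 2 / p)` is `0` unless `p = 2`, so these points can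
  -- lie outside the support; being countable, they are null.
  have hsub : Ioc a b \ {θ : ℝ | Real.cos θ = 0} ⊆
      (Function.support fun θ => |Real.cos θ| ^ (1 - 2 / p) * g θ) ∩ Ioc a b := by
    rintro θ ⟨hθ, hc⟩
    refine ⟨mul_ne_zero ?_ (h0 θ).ne', hθ⟩
    exact (Real.rpow_pos_of_pos (abs_pos.2 hc) _).ne'
  refine lt_of_lt_of_le ?_ (measure_mono hsub)
  rw [measure_sdiff_null (countable_cos_eq_zero.measure_zero _)]
  simpa using hab

theorem weightedPrimitive_zero : weightedPrimitive p g 0 = 0 :=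
  intervalIntegral.integral_same

theorem weightedPrimitive_neg (he : ∀ x, g (-x) = g x) (x : ℝ) :
    weightedPrimitive p g (-x) = -weightedPrimitive p g x := by
  have := intervalIntegral.integral_comp_neg (a := 0) (b := x)
    (fun θ => |Real.cos θ| ^ (1 - 2 / p) * g θ)
  simp only [Real.cos_neg, he, neg_zero] at this
  rw [weightedPrimitive, weightedPrimitive, this, intervalIntegral.integral_symm]

theorem weightedPrimitive_pi (hp : 1 < p) (hg : Continuous g)
    (hs : ∀ x, g (Real.pi - x) = g x) :
    weightedPrimitive p g Real.pi = 2 * weightedPrimitive p g (Real.pi / 2) := by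
  have h := weightedPrimitive_sub hp hg (Real.pi / 2) Real.pi
  have := intervalIntegral.integral_comp_sub_left (a := 0) (b := Real.pi / 2)
    (fun θ => |Real.cos θ| ^ (1 - 2 / p) * g θ) Real.pi
  simp only [Real.cos_pi_sub, abs_neg, hs, sub_zero] at this
  rw [show Real.pi - Real.pi / 2 = Real.pi / 2 by ring, ← h] at this
  change weightedPrimitive p g (Real.pi / 2) = _ at this
  linarith

theorem weightedPrimitive_add_pi (hp : 1 < p) (hg : Continuous g)
    (hper : Function.Periodic g Real.pi) (hs : ∀ x, g (Real.pi - x) = g x) (x : ℝ) :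
    weightedPrimitive p g (x + Real.pi) =
      weightedPrimitive p g x + 2 * weightedPrimitive p g (Real.pi / 2) := by
  have hper' : Function.Periodic (fun θ => |Real.cos θ| ^ (1 - 2 / p) * g θ) Real.pi := fun θ => by
    simp [Real.cos_add_pi, hper θ]
  have h := hper'.intervalIntegral_add_eq x 0
  rw [← weightedPrimitive_sub hp hg, zero_add] at h
  change _ = weightedPrimitive p g Real.pi at h
  rw [weightedPrimitive_pi hp hg hs] at h
  linarith

/-- Quasi-periodicity makes the values at `nπ` grow linearly, oddness gives the negative side, and
the intermediate value theorem fills in the rest. -/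
theorem surjective_weightedPrimitive (hp : 1 < p) (hg : Continuous g) (h0 : ∀ x, 0 < g x)
    (hper : Function.Periodic g Real.pi) (hs : ∀ x, g (Real.pi - x) = g x)
    (he : ∀ x, g (-x) = g x) :
    Function.Surjective (weightedPrimitive p g) := by
  have hmono := strictMono_weightedPrimitive hp hg h0
  have hK : 0 < weightedPrimitive p g (Real.pi / 2) := by
    have := hmono (show 0 < Real.pi / 2 by positivity)
    rwa [weightedPrimitive_zero] at this
  have hnat : ∀ n : ℕ, weightedPrimitive p g (n * Real.pi) =
      n * (2 * weightedPrimitive p g (Real.pi / 2)) := by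
    intro n
    induction n with
    | zero => simp [weightedPrimitive_zero]
    | succ n ih =>
      push_cast
      rw [add_mul, one_mul, weightedPrimitive_add_pi hp hg hper hs, ih]
      ring
  intro y
  obtain ⟨n, hn⟩ := exists_nat_gt (|y| / (2 * weightedPrimitive p g (Real.pi / 2)))
  rw [div_lt_iff₀ (by positivity), ← hnat] at hn
  obtain ⟨h1, h2⟩ := abs_lt.1 hn
  rw [← weightedPrimitive_neg he] at h1
  exact mem_range_of_exists_le_of_exists_ge (continuous_weightedPrimitive hp hg)
    ⟨_, h1.le⟩ ⟨_, h2.le⟩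

end weightedPrimitive

/-! ### The `p`-elliptic integrals and the amplitude -/

/-- The function `√(1 - q² sin² θ)`. -/
def delta (q θ : ℝ) : ℝ := Real.sqrt (1 - q ^ 2 * Real.sin θ ^ 2)

section amplitude

variable {p q : ℝ}

theorem continuous_delta : Continuous (delta q) := by
  unfold delta; fun_prop

theorem one_sub_pos (hq0 : 0 ≤ q) (hq1 : q < 1) (θ : ℝ) : 0 < 1 - q ^ 2 * Real.sin θ ^ 2 := by
  have h1 : q ^ 2 < 1 := by nlinarith
  nlinarith [Real.sin_sq_le_one θ, sq_nonneg (Real.sin θ), sq_nonneg q]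

theorem delta_pos (hq0 : 0 ≤ q) (hq1 : q < 1) (θ : ℝ) : 0 < delta q θ :=
  Real.sqrt_pos.2 (one_sub_pos hq0 hq1 θ)

theorem delta_sq (hq0 : 0 ≤ q) (hq1 : q < 1) (θ : ℝ) :
    delta q θ ^ 2 = 1 - q ^ 2 * Real.sin θ ^ 2 :=
  Real.sq_sqrt (one_sub_pos hq0 hq1 θ).le

theorem delta_neg (θ : ℝ) : delta q (-θ) = delta q θ := by simp [delta]

theorem delta_pi_sub (θ : ℝ) : delta q (Real.pi - θ) = delta q θ := by simp [delta]

theorem delta_periodic : Function.Periodic (delta q) Real.pi := fun θ => by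
  simp [delta, Real.sin_add_pi]

theorem E1_eq (p q x : ℝ) : E1 p x q = weightedPrimitive p (delta q) x := by
  simp only [E1, weightedPrimitive, delta, mul_comm]

theorem F1_eq (p q x : ℝ) : F1 p x q = weightedPrimitive p (fun θ => (delta q θ)⁻¹) x := by
  simp only [F1, weightedPrimitive, delta, div_eq_mul_inv]

theorem continuous_delta_inv (hq0 : 0 ≤ q) (hq1 : q < 1) :
    Continuous fun θ => (delta q θ)⁻¹ :=
  continuous_delta.inv₀ fun θ => (delta_pos hq0 hq1 θ).ne'

theorem strictMono_F1 (hp : 1 < p) (hq0 : 0 ≤ q) (hq1 : q < 1) :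
    StrictMono fun x => F1 p x q := by
  simp only [F1_eq]
  exact strictMono_weightedPrimitive hp (continuous_delta_inv hq0 hq1)
    fun θ => inv_pos.2 (delta_pos hq0 hq1 θ)

theorem surjective_F1 (hp : 1 < p) (hq0 : 0 ≤ q) (hq1 : q < 1) :
    Function.Surjective fun x => F1 p x q := by
  simp only [F1_eq]
  exact surjective_weightedPrimitive hp (continuous_delta_inv hq0 hq1)
    (fun θ => inv_pos.2 (delta_pos hq0 hq1 θ)) (fun θ => by simp [delta_periodic θ])
    (fun θ => by simp [delta_pi_sub θ]) (fun θ => by simp [delta_neg θ])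

theorem F1_am1 (hp : 1 < p) (hq0 : 0 ≤ q) (hq1 : q < 1) (s : ℝ) : F1 p (am1 p s q) q = s :=
  Function.rightInverse_invFun (surjective_F1 hp hq0 hq1) s

theorem am1_F1 (hp : 1 < p) (hq0 : 0 ≤ q) (hq1 : q < 1) (x : ℝ) : am1 p (F1 p x q) q = x :=
  Function.leftInverse_invFun (strictMono_F1 hp hq0 hq1).injective x

theorem K1_pos (hp : 1 < p) (hq0 : 0 ≤ q) (hq1 : q < 1) : 0 < K1 p q := by
  have := strictMono_F1 hp hq0 hq1 (show 0 < Real.pi / 2 by positivity)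
  simpa [F1_eq, weightedPrimitive_zero, K1] using this

theorem am1_neg_K1 (hp : 1 < p) (hq0 : 0 ≤ q) (hq1 : q < 1) :
    am1 p (-K1 p q) q = -(Real.pi / 2) := by
  rw [← am1_F1 hp hq0 hq1 (-(Real.pi / 2)), F1_eq,
    weightedPrimitive_neg (fun θ => by simp [delta_neg θ]), ← F1_eq, K1]

theorem am1_add (hp : 1 < p) (hq0 : 0 ≤ q) (hq1 : q < 1) (s : ℝ) :
    am1 p (s + 2 * K1 p q) q = am1 p s q + Real.pi := by
  rw [← am1_F1 hp hq0 hq1 (am1 p s q + Real.pi), F1_eq,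
    weightedPrimitive_add_pi hp (continuous_delta_inv hq0 hq1)
      (fun θ => by simp [delta_periodic θ]) (fun θ => by simp [delta_pi_sub θ]), ← F1_eq,
    F1_am1 hp hq0 hq1, ← F1_eq, K1]

theorem E1_add_pi (hp : 1 < p) (x : ℝ) : E1 p (x + Real.pi) q = E1 p x q + 2 * E1c p q := by
  rw [E1_eq, weightedPrimitive_add_pi hp continuous_delta delta_periodic delta_pi_sub,
    ← E1_eq, ← E1_eq, E1c]

theorem continuous_am1 (hp : 1 < p) (hq0 : 0 ≤ q) (hq1 : q < 1) :
    Continuous fun s => am1 p s q := by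
  let e := (strictMono_F1 hp hq0 hq1).orderIsoOfSurjective _ (surjective_F1 hp hq0 hq1)
  have : (fun s => am1 p s q) = e.symm := by
    funext s
    refine e.injective ?_
    rw [e.apply_symm_apply]
    exact F1_am1 hp hq0 hq1 s
  rw [this]
  exact e.symm.continuous

/-- Inverse function rule; the zeros of `cos` are excluded because the weight degenerates or blows
up there when `p ≠ 2`. -/
theorem hasDerivAt_am1 (hp : 1 < p) (hq0 : 0 ≤ q) (hq1 : q < 1) {s : ℝ}
    (hs : Real.cos (am1 p s q) ≠ 0) :
    HasDerivAt (fun s => am1 p s q)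
      (delta q (am1 p s q) / |Real.cos (am1 p s q)| ^ (1 - 2 / p)) s := by
  have hF := hasDerivAt_weightedPrimitive hp (continuous_delta_inv hq0 hq1) hs
  have := HasDerivAt.of_local_left_inverse (continuous_am1 hp hq0 hq1).continuousAt hF
    (mul_ne_zero (Real.rpow_pos_of_pos (abs_pos.2 hs) _).ne'
      (inv_ne_zero (delta_pos hq0 hq1 _).ne'))
    (Eventually.of_forall fun y => by rw [← F1_eq]; exact F1_am1 hp hq0 hq1 y)
  have he : delta q (am1 p s q) / |Real.cos (am1 p s q)| ^ (1 - 2 / p) =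
      (|Real.cos (am1 p s q)| ^ (1 - 2 / p) * (delta q (am1 p s q))⁻¹)⁻¹ := by
    rw [mul_inv, inv_inv, div_eq_mul_inv, mul_comm]
  rw [he]
  exact this

theorem countable_cos_am1_eq_zero (hp : 1 < p) (hq0 : 0 ≤ q) (hq1 : q < 1) :
    {s : ℝ | Real.cos (am1 p s q) = 0}.Countable := by
  refine (countable_cos_eq_zero.image fun x => F1 p x q).mono fun s hs => ?_
  exact ⟨am1 p s q, hs, F1_am1 hp hq0 hq1 s⟩

end amplitude

/-! ### Derivatives along the wavelike elastica -/

/-- A continuous function whose derivative exists off a countable set and extends continuously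
is differentiable everywhere. -/
theorem hasDerivAt_of_hasDerivAt_off_countable {f g : ℝ → ℝ} {S : Set ℝ} (hS : S.Countable)
    (hf : Continuous f) (hg : Continuous g) (h : ∀ x, x ∉ S → HasDerivAt f (g x) x) (x : ℝ) :
    HasDerivAt f (g x) x := by
  have hint : ∀ y, f y = f 0 + ∫ t in (0 : ℝ)..y, g t := fun y => by
    rw [MeasureTheory.integral_eq_of_hasDerivAt_off_countable f g hS hf.continuousOn
      (fun z hz => h z hz.2) (hg.intervalIntegrable 0 y)]
    ring
  rw [funext hint]
  exact (intervalIntegral.integral_hasDerivAt_right (hg.intervalIntegrable 0 x)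
    hg.stronglyMeasurable.stronglyMeasurableAtFilter hg.continuousAt).const_add _

/-- Only `0` is at issue, and there the absolute value is `|x| ^ (r + 1)` with a positive exponent.
-/
theorem continuous_abs_rpow_mul_self {r : ℝ} (hr : -1 < r) :
    Continuous fun x : ℝ => |x| ^ r * x := by
  rw [continuous_iff_continuousAt]
  intro x
  rcases eq_or_ne x 0 with rfl | hx
  · have h0 : (0 : ℝ) < r + 1 := by linarith
    have h : Tendsto (fun x : ℝ => |x| ^ (r + 1)) (𝓝 0) (𝓝 0) := by
      have : ContinuousAt (fun x : ℝ => |x| ^ (r + 1)) 0 :=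
        continuous_abs.continuousAt.rpow_const (Or.inr h0.le)
      simpa [ContinuousAt, Real.zero_rpow h0.ne'] using this
    rw [ContinuousAt, mul_zero]
    refine squeeze_zero_norm (fun y => ?_) h
    rcases eq_or_ne y 0 with rfl | hy
    · simp [Real.zero_rpow h0.ne']
    · rw [Real.rpow_add_one (abs_ne_zero.2 hy), norm_mul, Real.norm_of_nonneg (by positivity),
        Real.norm_eq_abs]
  · exact (continuous_abs.continuousAt.rpow_const (Or.inl (abs_ne_zero.2 hx))).mul continuousAt_id

theorem hasDerivAt_abs_rpow_mul_self (r : ℝ) {x : ℝ} (hx : x ≠ 0) :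
    HasDerivAt (fun x : ℝ => |x| ^ r * x) ((r + 1) * |x| ^ r) x := by
  have h := ((hasDerivAt_abs hx).rpow_const (p := r) (Or.inl (abs_ne_zero.2 hx))).mul
    (hasDerivAt_id x)
  have he : (r + 1) * |x| ^ r =
      (SignType.sign x : ℝ) * r * |x| ^ (r - 1) * id x + |x| ^ r * 1 := by
    have : |x| ^ r = |x| ^ (r - 1) * |x| := by
      rw [← Real.rpow_add_one (abs_ne_zero.2 hx)]; congr 1; ring
    rw [id, this, show (SignType.sign x : ℝ) * r * |x| ^ (r - 1) * x =
      r * |x| ^ (r - 1) * ((SignType.sign x : ℝ) * x) by ring, sign_mul_self]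
    ring
  rw [he]
  exact h

theorem hasDerivAt_plane {f g : ℝ → ℝ} {f' g' s : ℝ} (hf : HasDerivAt f f' s)
    (hg : HasDerivAt g g' s) :
    HasDerivAt (fun s => (!₂[f s, g s] : Plane)) !₂[f', g'] s := by
  have h : HasDerivAt (fun s => ![f s, g s]) ![f', g'] s := by
    rw [hasDerivAt_pi]
    intro i
    fin_cases i
    · exact hf
    · exact hg
  exact (PiLp.hasFDerivAt_toLp 2 ![f s, g s]).comp_hasDerivAt s h

section derivatives

variable {p q : ℝ}

theorem continuous_cn (hp : 1 < p) (hq0 : 0 ≤ q) (hq1 : q < 1) :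
    Continuous fun s => cn p s q :=
  (continuous_abs_rpow_mul_self (r := 2 / p - 1)
    (by linarith [one_sub_two_div_lt_one hp])).comp
      (Real.continuous_cos.comp (continuous_am1 hp hq0 hq1))

theorem continuous_delta_am1 (hp : 1 < p) (hq0 : 0 ≤ q) (hq1 : q < 1) :
    Continuous fun s => delta q (am1 p s q) :=
  continuous_delta.comp (continuous_am1 hp hq0 hq1)

theorem continuous_sin_am1 (hp : 1 < p) (hq0 : 0 ≤ q) (hq1 : q < 1) :
    Continuous fun s => Real.sin (am1 p s q) :=
  Real.continuous_sin.comp (continuous_am1 hp hq0 hq1)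

/-- The weight cancels in the chain rule, `(w δ)(δ / w) = δ²`, leaving a continuous function that
extends across the exceptional parameters. -/
theorem hasDerivAt_E1_am1 (hp : 1 < p) (hq0 : 0 ≤ q) (hq1 : q < 1) (s : ℝ) :
    HasDerivAt (fun s => E1 p (am1 p s q) q) (delta q (am1 p s q) ^ 2) s := by
  simp only [E1_eq]
  refine hasDerivAt_of_hasDerivAt_off_countable (countable_cos_am1_eq_zero hp hq0 hq1)
    ((continuous_weightedPrimitive hp continuous_delta).comp (continuous_am1 hp hq0 hq1))
    ((continuous_delta_am1 hp hq0 hq1).pow 2) (fun x hx => ?_) s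
  have h := (hasDerivAt_weightedPrimitive hp (continuous_delta (q := q)) hx).comp x
    (hasDerivAt_am1 hp hq0 hq1 hx)
  have hw : |Real.cos (am1 p x q)| ^ (1 - 2 / p) ≠ 0 :=
    (Real.rpow_pos_of_pos (abs_pos.2 hx) _).ne'
  refine h.congr_deriv ?_
  change _ = delta q (am1 p x q) ^ 2
  generalize |Real.cos (am1 p x q)| ^ (1 - 2 / p) = w at hw
  field_simp

theorem hasDerivAt_sin_am1 (hp : 1 < p) (hq0 : 0 ≤ q) (hq1 : q < 1) (s : ℝ) :
    HasDerivAt (fun s => Real.sin (am1 p s q)) (cn p s q * delta q (am1 p s q)) s := by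
  refine hasDerivAt_of_hasDerivAt_off_countable (countable_cos_am1_eq_zero hp hq0 hq1)
    (continuous_sin_am1 hp hq0 hq1)
    ((continuous_cn hp hq0 hq1).mul (continuous_delta_am1 hp hq0 hq1)) (fun x hx => ?_) s
  refine (hasDerivAt_am1 hp hq0 hq1 hx).sin.congr_deriv ?_
  change _ = cn p x q * delta q (am1 p x q)
  rw [cn, show 2 / p - 1 = -(1 - 2 / p) by ring, Real.rpow_neg (abs_nonneg _)]
  ring

theorem hasDerivAt_abs_cos_rpow_mul_cos_am1 (hp : 1 < p) (hq0 : 0 ≤ q) (hq1 : q < 1) (s : ℝ) :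
    HasDerivAt (fun s => |Real.cos (am1 p s q)| ^ (1 - 2 / p) * Real.cos (am1 p s q))
      (-(2 - 2 / p) * (Real.sin (am1 p s q) * delta q (am1 p s q))) s := by
  refine hasDerivAt_of_hasDerivAt_off_countable (countable_cos_am1_eq_zero hp hq0 hq1)
    ((continuous_abs_rpow_mul_self (neg_one_lt_one_sub_two_div hp)).comp
      (Real.continuous_cos.comp (continuous_am1 hp hq0 hq1)))
    (((continuous_sin_am1 hp hq0 hq1).mul (continuous_delta_am1 hp hq0 hq1)).const_mul _)
    (fun x hx => ?_) s
  have h := (hasDerivAt_abs_rpow_mul_self (1 - 2 / p) hx).comp x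
    (hasDerivAt_am1 hp hq0 hq1 hx).cos
  have hw : |Real.cos (am1 p x q)| ^ (1 - 2 / p) ≠ 0 :=
    (Real.rpow_pos_of_pos (abs_pos.2 hx) _).ne'
  refine h.congr_deriv ?_
  change _ = -(2 - 2 / p) * (Real.sin (am1 p x q) * delta q (am1 p x q))
  generalize |Real.cos (am1 p x q)| ^ (1 - 2 / p) = w at hw
  field_simp
  ring

/-- Differentiating through `sin am`, which is differentiable everywhere, avoids the exceptional
parameters of `am`. -/
theorem hasDerivAt_delta_am1 (hp : 1 < p) (hq0 : 0 ≤ q) (hq1 : q < 1) (s : ℝ) :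
    HasDerivAt (fun s => delta q (am1 p s q))
      (-(q ^ 2 * Real.sin (am1 p s q) * cn p s q)) s := by
  have h := ((((hasDerivAt_sin_am1 hp hq0 hq1 s).pow 2).const_mul (q ^ 2)).const_sub 1).sqrt
    (one_sub_pos hq0 hq1 (am1 p s q)).ne'
  refine h.congr_deriv ?_
  have hd := (delta_pos hq0 hq1 (am1 p s q)).ne'
  change _ / (2 * delta q (am1 p s q)) = _
  field_simp
  push_cast
  ring

/-- From `|cn_p| = |cos am| ^ (2 / p)` the exponents add up: `(2/p)(p - 2) + (2/p - 1) = 1 - 2/p`.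
-/
theorem abs_cn_rpow_mul_cn (hp : 1 < p) (s : ℝ) :
    |cn p s q| ^ (p - 2) * cn p s q =
      |Real.cos (am1 p s q)| ^ (1 - 2 / p) * Real.cos (am1 p s q) := by
  unfold cn
  set c := Real.cos (am1 p s q)
  rcases eq_or_ne c 0 with hc | hc
  · simp [hc]
  · have hc' := abs_pos.2 hc
    have h : |(|c| ^ (2 / p - 1) * c)| = |c| ^ (2 / p) := by
      rw [abs_mul, abs_of_nonneg (Real.rpow_nonneg hc'.le _), ← Real.rpow_add_one hc'.ne']
      congr 1; ring
    rw [h, ← mul_assoc, ← Real.rpow_mul hc'.le, ← Real.rpow_add hc']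
    congr 2
    have : p ≠ 0 := by linarith
    field_simp
    ring

theorem abs_cn_rpow (hp : 1 < p) (s : ℝ) : |cn p s q| ^ p = Real.cos (am1 p s q) ^ 2 := by
  unfold cn
  set c := Real.cos (am1 p s q)
  have hp0 : p ≠ 0 := by linarith
  rcases eq_or_ne c 0 with hc | hc
  · simp [hc, Real.zero_rpow hp0]
  · have hc' := abs_pos.2 hc
    have h : |(|c| ^ (2 / p - 1) * c)| = |c| ^ (2 / p) := by
      rw [abs_mul, abs_of_nonneg (Real.rpow_nonneg hc'.le _), ← Real.rpow_add_one hc'.ne']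
      congr 1; ring
    rw [h, ← Real.rpow_mul hc'.le, div_mul_cancel₀ _ hp0, ← sq_abs]
    norm_cast

/-- The unit tangent of the wavelike `p`-elastica. -/
def gammaWTangent (p q s : ℝ) : Plane :=
  !₂[1 - 2 * q ^ 2 * Real.sin (am1 p s q) ^ 2,
    2 * q * (Real.sin (am1 p s q) * delta q (am1 p s q))]

/-- The unit normal of the wavelike `p`-elastica. -/
def gammaWNormal (p q s : ℝ) : Plane :=
  !₂[-(2 * q * (Real.sin (am1 p s q) * delta q (am1 p s q))),
    1 - 2 * q ^ 2 * Real.sin (am1 p s q) ^ 2]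

theorem hasDerivAt_gammaW (hp : 1 < p) (hq0 : 0 ≤ q) (hq1 : q < 1) (s : ℝ) :
    HasDerivAt (fun s => gammaW p s q) (gammaWTangent p q s) s := by
  unfold gammaW gammaWTangent
  simp only [abs_cn_rpow_mul_cn hp]
  refine hasDerivAt_plane ?_ ?_
  · refine (((hasDerivAt_E1_am1 hp hq0 hq1 s).const_mul 2).sub (hasDerivAt_id s)).congr_deriv ?_
    rw [delta_sq hq0 hq1]
    ring
  · refine ((hasDerivAt_abs_cos_rpow_mul_cos_am1 hp hq0 hq1 s).const_mul
      (q * (p / (p - 1)))).neg.congr_deriv ?_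
    have : p ≠ 0 := by linarith
    have : p - 1 ≠ 0 := by linarith
    field_simp

/-- The Frenet equation, from which the curvature `2q cn_p` is read off. -/
theorem hasDerivAt_gammaWTangent (hp : 1 < p) (hq0 : 0 ≤ q) (hq1 : q < 1) (s : ℝ) :
    HasDerivAt (gammaWTangent p q) ((2 * q * cn p s q) • gammaWNormal p q s) s := by
  have h := hasDerivAt_plane
    ((((hasDerivAt_sin_am1 hp hq0 hq1 s).pow 2).const_mul (2 * q ^ 2)).const_sub 1)
    (((hasDerivAt_sin_am1 hp hq0 hq1 s).mul
      (hasDerivAt_delta_am1 hp hq0 hq1 s)).const_mul (2 * q))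
  refine h.congr_deriv ?_
  ext i
  have hd := delta_sq hq0 hq1 (am1 p s q)
  fin_cases i
  · simp [gammaWNormal]
    ring
  · simp [gammaWNormal]
    linear_combination 2 * q * cn p s q * hd

theorem continuous_gammaWNormal (hp : 1 < p) (hq0 : 0 ≤ q) (hq1 : q < 1) :
    Continuous (gammaWNormal p q) := by
  refine (PiLp.continuous_toLp 2 _).comp (continuous_pi fun i => ?_)
  have h1 := continuous_sin_am1 hp hq0 hq1
  have h2 := continuous_delta_am1 hp hq0 hq1
  fin_cases i
  · exact ((h1.mul h2).const_mul _).neg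
  · exact continuous_const.sub ((h1.pow 2).const_mul _)

theorem gammaWTangent_sq (hq0 : 0 ≤ q) (hq1 : q < 1) (s : ℝ) :
    gammaWTangent p q s 0 ^ 2 + gammaWTangent p q s 1 ^ 2 = 1 := by
  have hd := delta_sq hq0 hq1 (am1 p s q)
  simp only [gammaWTangent, PiLp.toLp_apply, Matrix.cons_val_zero, Matrix.cons_val_one]
  linear_combination 4 * q ^ 2 * Real.sin (am1 p s q) ^ 2 * hd

theorem norm_gammaWTangent (hq0 : 0 ≤ q) (hq1 : q < 1) (s : ℝ) :
    ‖gammaWTangent p q s‖ = 1 := by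
  rw [EuclideanSpace.norm_eq, Fin.sum_univ_two]
  simp only [Real.norm_eq_abs, sq_abs]
  rw [gammaWTangent_sq hq0 hq1, Real.sqrt_one]

end derivatives

/-! ### Length and bending energy of affinely parametrized arcs -/

section arcs

variable {p q : ℝ}

theorem hasDerivAt_gammaW_affine (hp : 1 < p) (hq0 : 0 ≤ q) (hq1 : q < 1) (l d t : ℝ) :
    HasDerivAt (fun t => gammaW p (l * t - d) q) (l • gammaWTangent p q (l * t - d)) t := by
  have h : HasDerivAt (fun t => l * t - d) l t := by
    simpa using ((hasDerivAt_id t).const_mul l).sub_const d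
  exact (hasDerivAt_gammaW hp hq0 hq1 (l * t - d)).scomp t h

theorem hasDerivAt_gammaWTangent_affine (hp : 1 < p) (hq0 : 0 ≤ q) (hq1 : q < 1) (l d t : ℝ) :
    HasDerivAt (fun t => l • gammaWTangent p q (l * t - d))
      (l • l • (2 * q * cn p (l * t - d) q) • gammaWNormal p q (l * t - d)) t := by
  have h : HasDerivAt (fun t => l * t - d) l t := by
    simpa using ((hasDerivAt_id t).const_mul l).sub_const d
  exact ((hasDerivAt_gammaWTangent hp hq0 hq1 (l * t - d)).scomp t h).const_smul l

theorem deriv_gammaW_affine (hp : 1 < p) (hq0 : 0 ≤ q) (hq1 : q < 1) (l d : ℝ) :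
    deriv (fun t => gammaW p (l * t - d) q) = fun t => l • gammaWTangent p q (l * t - d) :=
  funext fun t => (hasDerivAt_gammaW_affine hp hq0 hq1 l d t).deriv

theorem norm_deriv_gammaW_affine (hp : 1 < p) (hq0 : 0 ≤ q) (hq1 : q < 1) {l : ℝ} (hl : 0 < l)
    (d t : ℝ) : ‖deriv (fun t => gammaW p (l * t - d) q) t‖ = l := by
  rw [deriv_gammaW_affine hp hq0 hq1, norm_smul, norm_gammaWTangent hq0 hq1,
    Real.norm_of_nonneg hl.le, mul_one]

theorem signedCurvature_gammaW_affine (hp : 1 < p) (hq0 : 0 ≤ q) (hq1 : q < 1) {l : ℝ}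
    (hl : 0 < l) (d t : ℝ) :
    signedCurvature (fun t => gammaW p (l * t - d) q) t = 2 * q * cn p (l * t - d) q := by
  rw [signedCurvature, norm_deriv_gammaW_affine hp hq0 hq1 hl, deriv_gammaW_affine hp hq0 hq1,
    (hasDerivAt_gammaWTangent_affine hp hq0 hq1 l d t).deriv, div_eq_iff (by positivity)]
  have h := gammaWTangent_sq (p := p) hq0 hq1 (l * t - d)
  have h0 : gammaWNormal p q (l * t - d) 0 = -gammaWTangent p q (l * t - d) 1 := rfl
  have h1 : gammaWNormal p q (l * t - d) 1 = gammaWTangent p q (l * t - d) 0 := rfl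
  simp only [PiLp.smul_apply, smul_eq_mul, h0, h1]
  linear_combination l ^ 3 * (2 * q * cn p (l * t - d) q) * h

theorem curveLength_gammaW_affine (hp : 1 < p) (hq0 : 0 ≤ q) (hq1 : q < 1) {l : ℝ} (hl : 0 < l)
    (d a b : ℝ) : curveLength (fun t => gammaW p (l * t - d) q) a b = l * (b - a) := by
  simp only [curveLength, norm_deriv_gammaW_affine hp hq0 hq1 hl]
  simp [mul_comm]

theorem bendingEnergy_gammaW_affine (hp : 1 < p) (hq0 : 0 < q) (hq1 : q < 1) {l : ℝ}
    (hl : 0 < l) (d a b : ℝ) :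
    bendingEnergy p (fun t => gammaW p (l * t - d) q) a b =
      (2 * q) ^ p / q ^ 2 *
        (E1 p (am1 p (l * b - d) q) q - E1 p (am1 p (l * a - d) q) q -
          (1 - q ^ 2) * (l * (b - a))) := by
  -- The primitive comes from `|2q cn_p|^p = (2q)^p cos² am = ((2q)^p / q²)(δ² - (1 - q²))`.
  have hder : ∀ t, HasDerivAt (fun t => (2 * q) ^ p / q ^ 2 *
      (E1 p (am1 p (l * t - d) q) q - (1 - q ^ 2) * (l * t - d)))
      (|2 * q * cn p (l * t - d) q| ^ p * l) t := fun t => by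
    have h : HasDerivAt (fun t => l * t - d) l t := by
      simpa using ((hasDerivAt_id t).const_mul l).sub_const d
    have h1 := (hasDerivAt_E1_am1 hp hq0.le hq1 (l * t - d)).comp t h
    refine ((h1.sub (h.const_mul (1 - q ^ 2))).const_mul ((2 * q) ^ p / q ^ 2)).congr_deriv ?_
    rw [delta_sq hq0.le hq1, abs_mul, Real.mul_rpow (abs_nonneg _) (abs_nonneg _),
      abs_cn_rpow hp, abs_of_pos (by positivity), Real.cos_sq']
    field_simp
    ring
  have hc : Continuous fun t => |2 * q * cn p (l * t - d) q| ^ p * l := by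
    have := (continuous_cn hp hq0.le hq1).comp
      ((continuous_const.mul continuous_id).sub continuous_const : Continuous fun t => l * t - d)
    exact (((this.const_mul (2 * q)).abs.rpow_const fun _ => Or.inr (by linarith))).mul_const l
  simp only [bendingEnergy, norm_deriv_gammaW_affine hp hq0.le hq1 hl,
    signedCurvature_gammaW_affine hp hq0.le hq1 hl]
  rw [intervalIntegral.integral_eq_sub_of_hasDerivAt (fun t _ => hder t)
    (hc.intervalIntegrable a b)]
  ring

end arcs

/-! ### Existence of the modulus of the figure-eight -/

/-- The profile `u ↦ (1 - 2u) / √(1 - u)`, for which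
`2 E_{1,p}(q) - K_{1,p}(q) = ∫ |cos θ| ^ (1 - 2 / p) profile(q² sin² θ) dθ`. -/
def profile (u : ℝ) : ℝ := (1 - 2 * u) / Real.sqrt (1 - u)

theorem profile_le_one {u : ℝ} (h0 : 0 ≤ u) (h1 : u < 1) : profile u ≤ 1 := by
  have h : 0 < 1 - u := by linarith
  rw [profile, div_le_one (Real.sqrt_pos.2 h)]
  have : 1 - u ≤ Real.sqrt (1 - u) := Real.le_sqrt_of_sq_le (by nlinarith)
  linarith

theorem abs_profile_le {u v : ℝ} (h0 : 0 ≤ u) (huv : u ≤ v) (h1 : v < 1) :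
    |profile u| ≤ (Real.sqrt (1 - v))⁻¹ := by
  have hv : 0 < Real.sqrt (1 - v) := Real.sqrt_pos.2 (by linarith)
  rw [profile, abs_div, abs_of_nonneg (Real.sqrt_nonneg _), inv_eq_one_div]
  refine div_le_div₀ zero_le_one (abs_le.2 ⟨by linarith, by linarith⟩) hv ?_
  exact Real.sqrt_le_sqrt (by linarith)

theorem continuousAt_profile {u : ℝ} (h1 : u < 1) : ContinuousAt profile u := by
  have h : Real.sqrt (1 - u) ≠ 0 := (Real.sqrt_pos.2 (by linarith)).ne'
  unfold profile
  exact ContinuousAt.div (by fun_prop) (by fun_prop) h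

theorem measurable_profile : Measurable profile := by
  unfold profile
  fun_prop

section

variable {p q : ℝ}

theorem profile_sin_eq (hq0 : 0 ≤ q) (hq1 : q < 1) (θ : ℝ) :
    profile (q ^ 2 * Real.sin θ ^ 2) = 2 * delta q θ - (delta q θ)⁻¹ := by
  have h := (delta_pos hq0 hq1 θ).ne'
  have h2 := delta_sq hq0 hq1 θ
  change _ / delta q θ = _
  field_simp
  rw [h2]
  ring

theorem two_mul_E1c_sub_K1 (hp : 1 < p) (hq0 : 0 ≤ q) (hq1 : q < 1) :
    2 * E1c p q - K1 p q = ∫ θ in (0 : ℝ)..(Real.pi / 2),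
      |Real.cos θ| ^ (1 - 2 / p) * profile (q ^ 2 * Real.sin θ ^ 2) := by
  simp only [profile_sin_eq hq0 hq1]
  rw [E1c, K1, E1_eq, F1_eq, weightedPrimitive, weightedPrimitive,
    ← intervalIntegral.integral_const_mul, ← intervalIntegral.integral_sub
      ((intervalIntegrable_weight_mul hp continuous_delta 0 _).const_mul 2)
      (intervalIntegrable_weight_mul hp (continuous_delta_inv hq0 hq1) 0 _)]
  congr 1
  funext θ
  ring

theorem intervalIntegrable_weight_mul_profile (hp : 1 < p) (hq0 : 0 ≤ q) (hq1 : q < 1)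
    (a b : ℝ) : IntervalIntegrable
      (fun θ => |Real.cos θ| ^ (1 - 2 / p) * profile (q ^ 2 * Real.sin θ ^ 2)) volume a b := by
  simp only [profile_sin_eq hq0 hq1]
  exact intervalIntegrable_weight_mul hp
    ((continuous_delta.const_mul 2).sub (continuous_delta_inv hq0 hq1)) a b

/-- Dominated convergence; staying below `r < 1` bounds the profile uniformly by `1 / √(1 - r²)`. -/
theorem continuousOn_two_mul_E1c_sub_K1 (hp : 1 < p) {r : ℝ} (hr1 : r < 1) :
    ContinuousOn (fun q => 2 * E1c p q - K1 p q) (Icc 0 r) := by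
  refine ContinuousOn.congr (f := fun q => ∫ θ in (0 : ℝ)..(Real.pi / 2),
      |Real.cos θ| ^ (1 - 2 / p) * profile (q ^ 2 * Real.sin θ ^ 2)) ?_
    fun q hq => two_mul_E1c_sub_K1 hp hq.1 (hq.2.trans_lt hr1)
  intro q hq
  refine intervalIntegral.continuousWithinAt_of_dominated_interval
    (bound := fun θ => |Real.cos θ| ^ (1 - 2 / p) * (Real.sqrt (1 - r ^ 2))⁻¹) ?_ ?_ ?_ ?_
  · refine Eventually.of_forall fun x => ?_
    exact (((Real.measurable_cos.abs).pow_const _).mul (measurable_profile.comp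
      ((Real.measurable_sin.pow_const 2).const_mul _))).aestronglyMeasurable
  · filter_upwards [self_mem_nhdsWithin] with x hx
    refine Eventually.of_forall fun θ _ => ?_
    rw [norm_mul, Real.norm_of_nonneg (by positivity)]
    have h0 : (0 : ℝ) ≤ r := hx.1.trans hx.2
    refine mul_le_mul_of_nonneg_left (abs_profile_le (by positivity) ?_ (by nlinarith))
      (by positivity)
    calc x ^ 2 * Real.sin θ ^ 2 ≤ r ^ 2 * 1 :=
          mul_le_mul (pow_le_pow_left₀ hx.1 hx.2 2) (Real.sin_sq_le_one θ) (by positivity)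
            (by positivity)
      _ = r ^ 2 := mul_one _
  · exact intervalIntegrable_weight_mul hp continuous_const 0 _
  · refine Eventually.of_forall fun θ _ => ContinuousAt.continuousWithinAt ?_
    refine continuousAt_const.mul (ContinuousAt.comp
      (f := fun q : ℝ => q ^ 2 * Real.sin θ ^ 2) (continuousAt_profile ?_) (by fun_prop))
    linarith [one_sub_pos hq.1 (hq.2.trans_lt hr1) θ]

/-- The integrand of `2 E_{1,p}(q) - K_{1,p}(q)` folded onto `[0, π/4]`. -/
def foldedIntegrand (p q θ : ℝ) : ℝ :=
  |Real.cos θ| ^ (1 - 2 / p) * profile (q ^ 2 * Real.sin θ ^ 2) +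
    |Real.sin θ| ^ (1 - 2 / p) * profile (q ^ 2 * Real.cos θ ^ 2)

/-! ### Negativity of `2E - K` for moduli near `1` -/

theorem intervalIntegrable_folded_right (hp : 1 < p) (hq0 : 0 ≤ q) (hq1 : q < 1) :
    IntervalIntegrable
      (fun θ => |Real.sin θ| ^ (1 - 2 / p) * profile (q ^ 2 * Real.cos θ ^ 2)) volume 0
      (Real.pi / 4) := by
  have h := (intervalIntegrable_weight_mul_profile hp hq0 hq1 (Real.pi / 2)
    (Real.pi / 4)).comp_sub_left (Real.pi / 2)
  simp only [Real.cos_pi_div_two_sub, Real.sin_pi_div_two_sub] at h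
  convert h using 1 <;> ring

/-- The reflection `θ ↦ π/2 - θ` exchanges `sin` and `cos`. Folding matters because at `q = 1` the
original integrand changes sign at `π/4`, while the folded one does not. -/
theorem two_mul_E1c_sub_K1_eq_folded (hp : 1 < p) (hq0 : 0 ≤ q) (hq1 : q < 1) :
    2 * E1c p q - K1 p q = ∫ θ in (0 : ℝ)..(Real.pi / 4), foldedIntegrand p q θ := by
  have hi := intervalIntegrable_weight_mul_profile hp hq0 hq1
  have h := intervalIntegral.integral_comp_sub_left (a := 0) (b := Real.pi / 4)
    (fun θ => |Real.cos θ| ^ (1 - 2 / p) * profile (q ^ 2 * Real.sin θ ^ 2)) (Real.pi / 2)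
  simp only [Real.cos_pi_div_two_sub, Real.sin_pi_div_two_sub, sub_zero] at h
  rw [show Real.pi / 2 - Real.pi / 4 = Real.pi / 4 by ring] at h
  unfold foldedIntegrand
  rw [two_mul_E1c_sub_K1 hp hq0 hq1, intervalIntegral.integral_add (hi 0 _)
    (intervalIntegrable_folded_right hp hq0 hq1), h,
    intervalIntegral.integral_add_adjacent_intervals (hi _ _) (hi _ _)]

theorem sin_cos_bounds {θ : ℝ} (hθ : θ ∈ Ioc 0 (Real.pi / 4)) :
    0 < Real.sin θ ∧ 0 < Real.cos θ := by
  have := Real.pi_pos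
  exact ⟨Real.sin_pos_of_pos_of_lt_pi hθ.1 (by linarith [hθ.2]),
    Real.cos_pos_of_mem_Ioo ⟨by linarith [hθ.1], by linarith [hθ.2]⟩⟩

theorem foldedIntegrand_le (hq0 : 0 ≤ q) (hq1 : q ≤ 1) {θ : ℝ}
    (hθ : θ ∈ Ioc 0 (Real.pi / 4)) :
    foldedIntegrand p q θ ≤ |Real.cos θ| ^ (1 - 2 / p) + |Real.sin θ| ^ (1 - 2 / p) := by
  obtain ⟨hs, hc⟩ := sin_cos_bounds hθ
  have hq2 : q ^ 2 ≤ 1 := by nlinarith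
  have h := Real.sin_sq_add_cos_sq θ
  refine add_le_add (mul_le_of_le_one_right (by positivity)
    (profile_le_one (by positivity) ?_)) (mul_le_of_le_one_right (by positivity)
    (profile_le_one (by positivity) ?_)) <;> nlinarith [sq_pos_of_pos hs, sq_pos_of_pos hc]

/-- At `q = 1` the sum factors as `(cos² - sin²)(cos^(-2/p) - sin^(-2/p))`, and `0 < sin < cos` on
this interval. -/
theorem foldedIntegrand_one_neg (hp : 1 < p) {θ : ℝ} (hθ : θ ∈ Ioo 0 (Real.pi / 4)) :
    foldedIntegrand p 1 θ < 0 := by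
  obtain ⟨hs, hc⟩ := sin_cos_bounds ⟨hθ.1, hθ.2.le⟩
  have hsc : Real.sin θ < Real.cos θ := by
    rw [← Real.sin_pi_div_two_sub]
    exact Real.sin_lt_sin_of_lt_of_le_pi_div_two (by linarith [hθ.1, Real.pi_pos])
      (by linarith [hθ.1]) (by linarith [hθ.2])
  have h := Real.sin_sq_add_cos_sq θ
  have hpow : Real.cos θ ^ (1 - 2 / p - 1) < Real.sin θ ^ (1 - 2 / p - 1) :=
    Real.rpow_lt_rpow_of_neg hs hsc (by linarith [one_sub_two_div_lt_one hp])
  have he : foldedIntegrand p 1 θ = (Real.cos θ ^ 2 - Real.sin θ ^ 2) *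
      (Real.cos θ ^ (1 - 2 / p - 1) - Real.sin θ ^ (1 - 2 / p - 1)) := by
    rw [foldedIntegrand, profile, profile, abs_of_pos hs, abs_of_pos hc, one_pow, one_mul,
      one_mul, ← Real.cos_sq', ← Real.sin_sq, Real.sqrt_sq hs.le, Real.sqrt_sq hc.le,
      Real.rpow_sub_one hs.ne', Real.rpow_sub_one hc.ne',
      show 1 - 2 * Real.sin θ ^ 2 = Real.cos θ ^ 2 - Real.sin θ ^ 2 by linarith,
      show 1 - 2 * Real.cos θ ^ 2 = -(Real.cos θ ^ 2 - Real.sin θ ^ 2) by linarith]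
    ring
  rw [he]
  exact mul_neg_of_pos_of_neg (by nlinarith) (by linarith)

theorem measurable_foldedIntegrand : Measurable (foldedIntegrand p q) :=
  (((Real.measurable_cos.abs).pow_const _).mul (measurable_profile.comp
    ((Real.measurable_sin.pow_const 2).const_mul _))).add
  (((Real.measurable_sin.abs).pow_const _).mul (measurable_profile.comp
    ((Real.measurable_cos.pow_const 2).const_mul _)))

theorem continuousAt_foldedIntegrand_one {θ : ℝ} (hθ : θ ∈ Ioc 0 (Real.pi / 4)) :
    ContinuousAt (fun q => foldedIntegrand p q θ) 1 := by
  obtain ⟨hs, hc⟩ := sin_cos_bounds hθ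
  have h := Real.sin_sq_add_cos_sq θ
  refine (continuousAt_const.mul (ContinuousAt.comp (f := fun q : ℝ => q ^ 2 * Real.sin θ ^ 2)
    (continuousAt_profile ?_) (by fun_prop))).add
    (continuousAt_const.mul (ContinuousAt.comp (f := fun q : ℝ => q ^ 2 * Real.cos θ ^ 2)
    (continuousAt_profile ?_) (by fun_prop))) <;> nlinarith

theorem norm_max_foldedIntegrand_le (hq0 : 0 ≤ q) (hq1 : q ≤ 1) {θ : ℝ}
    (hθ : θ ∈ Ioc 0 (Real.pi / 4)) :
    ‖max (foldedIntegrand p q θ) (-1)‖ ≤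
      |Real.cos θ| ^ (1 - 2 / p) + |Real.sin θ| ^ (1 - 2 / p) + 1 := by
  have h := foldedIntegrand_le (p := p) hq0 hq1 hθ
  have h0 : 0 ≤ |Real.cos θ| ^ (1 - 2 / p) + |Real.sin θ| ^ (1 - 2 / p) := by positivity
  rw [Real.norm_eq_abs, abs_le]
  exact ⟨by linarith [le_max_right (foldedIntegrand p q θ) (-1)],
    max_le (by linarith) (by linarith)⟩

theorem intervalIntegrable_folded_bound (hp : 1 < p) :
    IntervalIntegrable (fun θ => |Real.cos θ| ^ (1 - 2 / p) + |Real.sin θ| ^ (1 - 2 / p) + 1)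
      volume 0 (Real.pi / 4) := by
  have h := neg_one_lt_one_sub_two_div hp
  have hpi := Real.pi_pos
  refine ((intervalIntegrable_cos_rpow h _ _).add ((intervalIntegrable_sin_rpow h).mono_set
    ?_)).add intervalIntegrable_const
  rw [uIcc_of_le (by linarith), uIcc_of_le (by linarith)]
  exact Icc_subset_Icc_right (by linarith)

theorem intervalIntegrable_max_foldedIntegrand (hp : 1 < p) (hq0 : 0 ≤ q) (hq1 : q ≤ 1) :
    IntervalIntegrable (fun θ => max (foldedIntegrand p q θ) (-1)) volume 0
      (Real.pi / 4) := by
  refine (intervalIntegrable_folded_bound hp).mono_fun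
    (measurable_foldedIntegrand.max measurable_const).aestronglyMeasurable ?_
  rw [uIoc_of_le (by positivity)]
  filter_upwards [ae_restrict_mem measurableSet_Ioc] with θ hθ
  exact (norm_max_foldedIntegrand_le hq0 hq1 hθ).trans (le_abs_self _)

/-- For `p ≤ 2` the folded integrand at `q = 1` is not integrable near `0`. Truncating it below at
`-1` gives an integrable two-sided bound, so the truncated integral is continuous as `q → 1` and its
limit is negative; it dominates `2E - K`. -/
theorem exists_two_mul_E1c_sub_K1_neg (hp : 1 < p) :
    ∃ q ∈ Ioo (0 : ℝ) 1, 2 * E1c p q - K1 p q < 0 := by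
  have hpi : (0 : ℝ) < Real.pi / 4 := by positivity
  have hcont : ContinuousWithinAt
      (fun q => ∫ θ in (0 : ℝ)..(Real.pi / 4), max (foldedIntegrand p q θ) (-1)) (Ioo 0 1) 1 := by
    refine intervalIntegral.continuousWithinAt_of_dominated_interval ?_ ?_
      (intervalIntegrable_folded_bound hp) ?_
    · exact Eventually.of_forall fun q =>
        (measurable_foldedIntegrand.max measurable_const).aestronglyMeasurable
    · filter_upwards [self_mem_nhdsWithin] with q hq
      refine Eventually.of_forall fun θ hθ => ?_
      rw [uIoc_of_le hpi.le] at hθ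
      exact norm_max_foldedIntegrand_le hq.1.le hq.2.le hθ
    · refine Eventually.of_forall fun θ hθ => ?_
      rw [uIoc_of_le hpi.le] at hθ
      exact ContinuousAt.continuousWithinAt
        ((continuousAt_foldedIntegrand_one hθ).max continuousAt_const)
  have hneg : ∫ θ in (0 : ℝ)..(Real.pi / 4), max (foldedIntegrand p 1 θ) (-1) < 0 := by
    have h := intervalIntegral.intervalIntegral_pos_of_pos_on
      (intervalIntegrable_max_foldedIntegrand hp zero_le_one le_rfl).neg
      (fun θ hθ => neg_pos.2 (max_lt (foldedIntegrand_one_neg hp hθ) (by norm_num))) hpi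
    simp only [Pi.neg_apply, intervalIntegral.integral_neg] at h
    linarith
  have hne : (𝓝[Ioo (0 : ℝ) 1] 1).NeBot := right_nhdsWithin_Ioo_neBot zero_lt_one
  obtain ⟨q, hlt, hq⟩ := ((hcont.eventually_lt continuousWithinAt_const hneg).and
    self_mem_nhdsWithin).exists
  refine ⟨q, hq, lt_of_le_of_lt ?_ hlt⟩
  rw [two_mul_E1c_sub_K1_eq_folded hp hq.1.le hq.2]
  exact intervalIntegral.integral_mono_on hpi.le
    ((intervalIntegrable_weight_mul_profile hp hq.1.le hq.2 _ _).add
      (intervalIntegrable_folded_right hp hq.1.le hq.2))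
    (intervalIntegrable_max_foldedIntegrand hp hq.1.le hq.2.le) fun θ _ => le_max_left _ _

theorem two_mul_E1c_sub_K1_zero_pos (hp : 1 < p) : 0 < 2 * E1c p 0 - K1 p 0 := by
  have h := strictMono_weightedPrimitive (g := fun _ => 1) hp continuous_const
    (fun _ => one_pos) (show 0 < Real.pi / 2 by positivity)
  rw [weightedPrimitive_zero] at h
  rw [two_mul_E1c_sub_K1 hp le_rfl one_pos]
  simpa [profile, weightedPrimitive] using h

theorem exists_Q_eq_zero (hp : 1 < p) : ∃ q : ℝ, q ∈ Ioo (0 : ℝ) 1 ∧ Q p q = 0 := by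
  obtain ⟨r, hr, hneg⟩ := exists_two_mul_E1c_sub_K1_neg hp
  obtain ⟨q, hq, h⟩ := intermediate_value_Ioo' hr.1.le
    (continuousOn_two_mul_E1c_sub_K1 hp hr.2) ⟨hneg, two_mul_E1c_sub_K1_zero_pos hp⟩
  have hq1 : q < 1 := hq.2.trans hr.2
  refine ⟨q, ⟨hq.1, hq1⟩, ?_⟩
  have hK := (K1_pos hp hq.1.le hq1).ne'
  rw [Q]
  field_simp
  rw [mul_zero]
  exact h

theorem qStar_mem (hp : 1 < p) : qStar p ∈ Ioo (0 : ℝ) 1 :=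
  (Classical.epsilon_spec (exists_Q_eq_zero hp)).1

/-- Besides `0 < q^* < 1`, the only property of the modulus that is used. -/
theorem K1_qStar (hp : 1 < p) : K1 p (qStar p) = 2 * E1c p (qStar p) := by
  have h : Q p (qStar p) = 0 := (Classical.epsilon_spec (exists_Q_eq_zero hp)).2
  have hK := (K1_pos hp (qStar_mem hp).1.le (qStar_mem hp).2).ne'
  rw [Q] at h
  field_simp at h
  linarith

end

/-! ### Periodicity and energy of the figure-eight -/

section figureEight

variable {p q : ℝ}

theorem am1_add_nat_mul (hp : 1 < p) (hq0 : 0 ≤ q) (hq1 : q < 1) (s : ℝ) (n : ℕ) :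
    am1 p (s + n * (2 * K1 p q)) q = am1 p s q + n * Real.pi := by
  induction n with
  | zero => simp
  | succ n ih =>
    push_cast
    rw [add_mul, one_mul, ← add_assoc, am1_add hp hq0 hq1, ih]
    ring

theorem E1_am1_add_nat_mul (hp : 1 < p) (hq0 : 0 ≤ q) (hq1 : q < 1) (s : ℝ) (n : ℕ) :
    E1 p (am1 p (s + n * (2 * K1 p q)) q) q = E1 p (am1 p s q) q + n * (2 * E1c p q) := by
  induction n with
  | zero => simp
  | succ n ih =>
    push_cast
    rw [add_mul, one_mul, ← add_assoc, am1_add hp hq0 hq1, E1_add_pi hp, ih]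
    ring

/-- The first coordinate gains `n(4E - 2K) = 0`; the second is a function of `cos am`, which is
multiplied by `(-1)^n`. -/
theorem gammaW_add_nat_mul_of_even (hp : 1 < p) (s : ℝ) {n : ℕ} (hn : Even n) :
    gammaW p (s + n * (2 * K1 p (qStar p))) (qStar p) = gammaW p s (qStar p) := by
  obtain ⟨hq0, hq1⟩ := qStar_mem hp
  have hcos : Real.cos (am1 p (s + n * (2 * K1 p (qStar p))) (qStar p)) =
      Real.cos (am1 p s (qStar p)) := by
    rw [am1_add_nat_mul hp hq0.le hq1, Real.cos_add_nat_mul_pi, hn.neg_one_pow, one_mul]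
  rw [gammaW, gammaW, abs_cn_rpow_mul_cn hp, abs_cn_rpow_mul_cn hp, hcos,
    E1_am1_add_nat_mul hp hq0.le hq1, K1_qStar hp,
    show ∀ x y : ℝ, 2 * (x + n * (2 * E1c p (qStar p))) - (y + n * (2 * (2 * E1c p (qStar p)))) =
      2 * x - y from fun x y => by ring]

/-- Here `am = -π/2`, so `cos am` vanishes and its sign is irrelevant: odd `n` is allowed too. -/
theorem gammaW_neg_K1_add_nat_mul (hp : 1 < p) (n : ℕ) :
    gammaW p (-K1 p (qStar p) + n * (2 * K1 p (qStar p))) (qStar p) =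
      gammaW p (-K1 p (qStar p)) (qStar p) := by
  obtain ⟨hq0, hq1⟩ := qStar_mem hp
  have hcos : Real.cos (am1 p (-K1 p (qStar p)) (qStar p)) = 0 := by
    rw [am1_neg_K1 hp hq0.le hq1, Real.cos_neg, Real.cos_pi_div_two]
  have hcos' : Real.cos (am1 p (-K1 p (qStar p) + n * (2 * K1 p (qStar p))) (qStar p)) = 0 := by
    rw [am1_add_nat_mul hp hq0.le hq1, Real.cos_add_nat_mul_pi, hcos, mul_zero]
  rw [gammaW, gammaW, abs_cn_rpow_mul_cn hp, abs_cn_rpow_mul_cn hp, hcos, hcos',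
    E1_am1_add_nat_mul hp hq0.le hq1, K1_qStar hp,
    show ∀ x y : ℝ, 2 * (x + n * (2 * E1c p (qStar p))) - (y + n * (2 * (2 * E1c p (qStar p)))) =
      2 * x - y from fun x y => by ring]

/-- The speed `l` is free so as to cover both the arclength arc (`l = 1`) and the loop on `[0, 1]`
(`l = 2nK`). -/
theorem normalizedEnergy_figureEight (hp : 1 < p) {l : ℝ} (hl : 0 < l) {n : ℕ} (hn : 0 < n) :
    normalizedEnergy p (fun t => gammaW p (l * t - K1 p (qStar p)) (qStar p)) 0
      (2 * n * K1 p (qStar p) / l) = varpiStar p * (n : ℝ) ^ p := by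
  obtain ⟨hq0, hq1⟩ := qStar_mem hp
  have hK := K1_qStar hp
  have hKpos := K1_pos hp hq0.le hq1
  have hA := E1_am1_add_nat_mul hp hq0.le hq1 (-K1 p (qStar p)) n
  have hn' : (0 : ℝ) < n := by exact_mod_cast hn
  rw [normalizedEnergy, curveLength_gammaW_affine hp hq0.le hq1 hl,
    bendingEnergy_gammaW_affine hp hq0 hq1 hl, sub_zero, mul_zero, zero_sub,
    mul_div_cancel₀ _ hl.ne',
    show 2 * n * K1 p (qStar p) - K1 p (qStar p) =
      -K1 p (qStar p) + n * (2 * K1 p (qStar p)) by ring, hA, varpiStar]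
  -- With `K = 2e` the energy reads `(4ne)^(p-1) ((2q)^p / q²)(2ne - (1 - q²) 4ne)`, and the last
  -- factor is `2ne(2q² - 1)`.
  rw [hK] at hKpos ⊢
  set q := qStar p
  set e := E1c p q
  have he : 0 < e := by linarith
  have h2 : (4 : ℝ) ^ p = 2 ^ p * 2 ^ p := by
    rw [← Real.mul_rpow (by norm_num) (by norm_num)]; norm_num
  have h3 : (2 : ℝ) ^ (3 * p - 1) = 2 ^ p * 2 ^ p * 2 ^ p / 2 := by
    rw [Real.rpow_sub_one (by norm_num), ← Real.rpow_add (by norm_num),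
      ← Real.rpow_add (by norm_num)]
    congr 2; ring
  have h4 : q ^ (p - 2) = q ^ p / q ^ 2 := by
    rw [Real.rpow_sub hq0]; norm_cast
  rw [show 2 * (n : ℝ) * (2 * e) = 4 * (n * e) by ring, Real.rpow_sub_one (by positivity),
    Real.mul_rpow (by norm_num) (by positivity), Real.mul_rpow hn'.le he.le,
    Real.mul_rpow (by norm_num) hq0.le, h2, h3, h4]
  field_simp
  ring

/-! ### The closed figure-eight -/

/-- The standard `n/2`-fold figure-eight, parametrized on `[0, 1]`. -/
def figureEightLoop (p : ℝ) (n : ℕ) (t : ℝ) : Plane :=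
  gammaW p (2 * n * K1 p (qStar p) * t - K1 p (qStar p)) (qStar p)

theorem figureEightLoop_periodic (hp : 1 < p) {n : ℕ} (hn : Even n) :
    Function.Periodic (figureEightLoop p n) 1 := fun t => by
  refine Eq.trans ?_ (gammaW_add_nat_mul_of_even hp _ hn)
  rw [figureEightLoop]
  congr 1
  ring

/-! ### Weak derivatives and descent to the circle -/

theorem periodic_deriv {f : ℝ → Plane} {c : ℝ} (hf : Function.Periodic f c) :
    Function.Periodic (deriv f) c := fun x => by
  rw [← deriv_comp_add_const, funext hf]

theorem hasWeakDeriv_of_hasDerivAt {u v : ℝ → Plane} (hv : Continuous v)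
    (h : ∀ x, HasDerivAt u (v x) x) : HasWeakDeriv u v := by
  have hu : Continuous u := continuous_iff_continuousAt.2 fun x => (h x).continuousAt
  refine ⟨hu.locallyIntegrable, hv.locallyIntegrable, fun φ hφ hcs => ?_⟩
  have hφ' : Continuous (deriv φ) := hφ.continuous_deriv (by simp)
  have h1 : Integrable fun x => φ x • v x :=
    (hφ.continuous.smul hv).integrable_of_hasCompactSupport hcs.smul_right
  have h2 : Integrable fun x => deriv φ x • u x :=
    (hφ'.smul hu).integrable_of_hasCompactSupport hcs.deriv.smul_right
  have h3 : Integrable fun x => φ x • u x :=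
    (hφ.continuous.smul hu).integrable_of_hasCompactSupport hcs.smul_right
  have hd : ∀ x, HasDerivAt φ (deriv φ x) x := fun x =>
    ((hφ.differentiable (by simp)) x).hasDerivAt
  have := integral_bilinear_hasDerivAt_right_eq_neg_left_of_integrable
    (L := ContinuousLinearMap.lsmul ℝ ℝ) (fun x _ => hd x) (fun x _ => h x) h1 h2 h3
  simp only [ContinuousLinearMap.lsmul_apply] at this
  rw [this, neg_neg]

theorem lift_periodic_lift {f : ℝ → Plane} (hf : Function.Periodic f 1) : lift hf.lift = f :=
  funext fun t => hf.lift_coe t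

theorem continuous_periodic_lift {f : ℝ → Plane} (hf : Function.Periodic f 1)
    (hc : Continuous f) : Continuous (hf.lift : UnitAddCircle → Plane) :=
  continuous_coinduced_dom.2 hc

/-- The loop is in fact `C²`, as `cn_p` is continuous: its second derivative is classical, and
bounded on the compact circle. -/
theorem isImmersedClosedW2p_figureEightLoop (hp : 1 < p) {n : ℕ} (hn0 : 0 < n)
    (hn : Function.Periodic (figureEightLoop p n) 1) :
    IsImmersedClosedW2p p hn.lift := by
  obtain ⟨hq0, hq1⟩ := qStar_mem hp
  have hK := K1_pos hp hq0.le hq1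
  have hn' : (0 : ℝ) < n := by exact_mod_cast hn0
  set l := 2 * n * K1 p (qStar p) with hl_def
  have hl : 0 < l := by positivity
  have hd := deriv_gammaW_affine hp hq0.le hq1 l (K1 p (qStar p))
  have hd1 := hasDerivAt_gammaW_affine hp hq0.le hq1 l (K1 p (qStar p))
  have hd2 := hasDerivAt_gammaWTangent_affine hp hq0.le hq1 l (K1 p (qStar p))
  change deriv (figureEightLoop p n) = _ at hd
  have hdd : ∀ t, HasDerivAt (deriv (figureEightLoop p n))
      (deriv (deriv (figureEightLoop p n)) t) t := by
    rw [hd]; exact fun t => (hd2 t).differentiableAt.hasDerivAt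
  have hcont : Continuous (deriv (deriv (figureEightLoop p n))) := by
    rw [hd, funext fun t => (hd2 t).deriv]
    have ha : Continuous fun t : ℝ => l * t - K1 p (qStar p) := by fun_prop
    exact (((((continuous_cn hp hq0.le hq1).comp ha).const_mul _).smul
      ((continuous_gammaWNormal hp hq0.le hq1).comp ha)).const_smul l).const_smul l
  have hper := periodic_deriv (periodic_deriv hn)
  refine ⟨?_, ⟨hper.lift, ?_, ?_⟩, ?_⟩
  · rw [lift_periodic_lift, contDiff_one_iff_deriv]
    exact ⟨fun t => (hd1 t).differentiableAt,
      continuous_iff_continuousAt.2 fun t => (hdd t).continuousAt⟩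
  · exact (continuous_periodic_lift hper hcont).memLp_of_hasCompactSupport
      (HasCompactSupport.of_compactSpace _)
  · rw [lift_periodic_lift, lift_periodic_lift]
    exact hasWeakDeriv_of_hasDerivAt hcont hdd
  · intro t
    rw [lift_periodic_lift, ← norm_ne_zero_iff]
    exact (norm_deriv_gammaW_affine hp hq0.le hq1 hl _ t).trans_ne hl.ne'

theorem hasPointOfMultiplicity_figureEightLoop (hp : 1 < p) {n : ℕ} (hn0 : 0 < n)
    (hn : Function.Periodic (figureEightLoop p n) 1) :
    HasPointOfMultiplicity hn.lift n := by
  have hn' : (0 : ℝ) < n := by exact_mod_cast hn0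
  -- The parameter `j / n` corresponds to `s = -K + 2jK`, where the curve is back at its starting
  -- point.
  let f : Fin n → UnitAddCircle := fun j => ((j / n : ℝ) : UnitAddCircle)
  have hf : Function.Injective f := fun i j hij => by
    have hmem : ∀ k : Fin n, (k / n : ℝ) ∈ Ico (0 : ℝ) (0 + 1) := fun k => by
      refine ⟨by positivity, ?_⟩
      rw [zero_add, div_lt_one hn']
      exact_mod_cast k.2
    have h := (AddCircle.coe_eq_coe_iff_of_mem_Ico (hmem i) (hmem j)).1 hij
    rw [div_left_inj' hn'.ne'] at h
    exact Fin.ext (by exact_mod_cast h)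
  refine ⟨gammaW p (-K1 p (qStar p)) (qStar p), ?_⟩
  have hr : (n : ℕ∞) = (range f).encard := by
    rw [← image_univ, hf.encard_image, encard_univ, ENat.card_eq_coe_fintype_card,
      Fintype.card_fin]
  rw [hr]
  refine encard_le_encard ?_
  rintro _ ⟨j, rfl⟩
  change figureEightLoop p n (j / n) = _
  rw [← gammaW_neg_K1_add_nat_mul hp j, figureEightLoop]
  congr 1
  field_simp
  ring

theorem isFigureEight_figureEightLoop (hp : 1 < p) {n : ℕ} (hn0 : 0 < n) :
    IsFigureEight p n (figureEightLoop p n) := by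
  obtain ⟨hq0, hq1⟩ := qStar_mem hp
  have hK := K1_pos hp hq0.le hq1
  have hn' : (0 : ℝ) < n := by exact_mod_cast hn0
  refine ⟨DilationEquiv.refl Plane, fun t => 2 * n * K1 p (qStar p) * t, ?_, fun t ht => ?_,
    mul_zero _, mul_one _, fun t _ => rfl⟩
  · exact ContDiff.contDiffOn (by fun_prop)
  · have h : HasDerivAt (fun t => 2 * n * K1 p (qStar p) * t) (2 * n * K1 p (qStar p)) t := by
      simpa using (hasDerivAt_id t).const_mul (2 * n * K1 p (qStar p))
    rw [h.hasDerivWithinAt.derivWithin (uniqueDiffOn_Icc zero_lt_one t ht)]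
    positivity

end figureEight

end PElastica

end

/-- The first conjunct says that `ϖ^*_p` is the normalized `p`-bending energy of the half-fold
figure-eight `p`-elastica; the second is the optimality for even multiplicity. -/
theorem theorem1p5 (p : ℝ) (hp : 1 < p) :
    PElastica.normalizedEnergy p (PElastica.figureEightArc p) 0
        (2 * PElastica.K1 p (PElastica.qStar p)) = PElastica.varpiStar p ∧
    ∀ m : ℕ, 2 ≤ m → Even m →
      ∃ γ : UnitAddCircle → PElastica.Plane,
        PElastica.IsImmersedClosedW2p p γ ∧
        PElastica.HasPointOfMultiplicity γ m ∧
        PElastica.normalizedEnergy p (PElastica.lift γ) 0 1 =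
          PElastica.varpiStar p * (m : ℝ) ^ p ∧
        PElastica.IsFigureEight p m (PElastica.lift γ) := by
  obtain ⟨hq0, hq1⟩ := PElastica.qStar_mem hp
  have hK := PElastica.K1_pos hp hq0.le hq1
  refine ⟨?_, fun m hm hme => ?_⟩
  · have h := PElastica.normalizedEnergy_figureEight hp one_pos one_pos
    simp only [one_mul, Nat.cast_one, mul_one, div_one, Real.one_rpow] at h
    exact h
  · have hm0 : 0 < m := by omega
    have hm' : (0 : ℝ) < m := by exact_mod_cast hm0
    have hper := PElastica.figureEightLoop_periodic hp hme
    refine ⟨hper.lift, PElastica.isImmersedClosedW2p_figureEightLoop hp hm0 hper,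
      PElastica.hasPointOfMultiplicity_figureEightLoop hp hm0 hper, ?_, ?_⟩
    · have hl : 0 < 2 * m * PElastica.K1 p (PElastica.qStar p) := by positivity
      have h := PElastica.normalizedEnergy_figureEight hp hl hm0
      rw [div_self hl.ne'] at h
      rw [PElastica.lift_periodic_lift]
      exact h
    · rw [PElastica.lift_periodic_lift]
      exact PElastica.isFigureEight_figureEightLoop hp hm0
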